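/- There is an absolute constant $C$ such that the following holds for every integer $d\ge 2$. Let $L\subset\mathbb{R}^d$ be a line with either choice of orientation, let $x\in L$, let $\mu\in\mathbb{R}^d$ and $\sigma>0$, and let $y$ be a Gaussian random vector in $\mathbb{R}^d$ with mean $\mu$ and covariance matrix $\sigma^2 I_d$. Let $\phi\in[0,\pi]$ be the angle between (the direction of) $L$ and $x-y$, let $R=\|x-y\|$ and $s=\|x-\mu\|$. Then $\phi$ has a conditional density given $R$, that is, there are probability densities $f_{\phi|R=r}$ on $[0,\pi]$, $r>0$, with $$\mathbb{P}(R\in B,\ \phi\in A)=\int_B\int_{A\cap[0,\pi]} f_{\phi|R=r}(\varphi)\,d\varphi\;d\mathbb{P}_R(r)\qquad\text{for all Borel sets } A,B\subseteq\mathbb{R},$$ and they can be chosen so that $f_{\phi|R=r}(\varphi)$ is continuous in $(r,\varphi)\in(0,\infty)\times[0,\pi]$. For this continuous version and for every $r>0$, $$\sup_{\varphi\in[0,\pi]} f_{\phi|R=r}(\varphi)\le C\left(\sqrt d+\frac{\sqrt{rs}}{\sigma}\right),$$ and moreover, if $d\ge 3$, $$\sup_{\varphi\in(0,\pi)}\frac{f_{\phi|R=r}(\varphi)}{\sin\varphi}\le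 C\left(\sqrt d+\frac{rs}{\sigma^2\sqrt d}\right).$$ -/

import Mathlib

open MeasureTheory ProbabilityTheory Set

/-- `f` is the (continuous) density of the angle `Φ` (with values in `[0, π]`) conditioned on the
outcome of the nonnegative random variable `R`; here `f r φ` is the density at `φ`, given `R = r`.

For every `r > 0`, `f r` is a probability density on `[0, π]`; the densities `f r` disintegrate the
joint law of `(R, Φ)` over the law of `R`; and `(r, φ) ↦ f r φ` is continuous on
`(0, ∞) × [0, π]`.
A disintegration alone fixes `f r` only for almost all `r` and `f r φ` only for almost all `φ`;
continuity makes the value at each specific `r > 0` and `φ` meaningful. -/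
structure IsCondAngleDensity {Ω : Type*} [MeasurableSpace Ω] (P : Measure Ω) (Φ R : Ω → ℝ)
    (f : ℝ → ℝ → ℝ) : Prop where
  continuousOn : ContinuousOn (fun p : ℝ × ℝ => f p.1 p.2) (Ioi 0 ×ˢ Icc 0 Real.pi)
  nonneg : ∀ r > 0, ∀ φ ∈ Icc 0 Real.pi, 0 ≤ f r φ
  integral_eq_one : ∀ r > 0, ∫ φ in Icc 0 Real.pi, f r φ = 1
  disintegration : ∀ A B : Set ℝ, MeasurableSet A → MeasurableSet B →
    P {ω | R ω ∈ B ∧ Φ ω ∈ A} =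
      ∫⁻ r in B, (∫⁻ φ in A ∩ Icc 0 Real.pi, ENNReal.ofReal (f r φ)) ∂(P.map R)

/-! Put m = x - μ, u = v/‖v‖ and p = d - 2. In spherical coordinates around the axis u, the Gaussian
density of x - y splits into a factor depending only on r and the exponential of an inner product.
Integrating over the directions w orthogonal to u, the angle given R = r has density F/∫F, where
F(φ) = |sin φ|^p ∫ exp(a cos φ + sin φ ⟪q, w⟫) dν(w). Here a² + ‖q‖² = κ² with κ = rs/σ². The law of
R has a positive density on (0, ∞), so every continuous version of the conditional density is this
one (`IsCondAngleDensity.eqOn`).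

It remains to bound F by a multiple of its own integral. For fixed w the exponent is a sinusoid, so
its values at φ ± δ sum to 2 cos δ times the value at φ, and sin(φ+δ) sin(φ-δ) = sin² φ - sin² δ.
Hence F(φ) ≤ F(φ+δ) + F(φ-δ) for all δ up to order 1/√(p+2+κ), provided φ is not too near a pole
(`angularProfile_le_add`). Averaging over δ gives F(φ) ≲ √(p+2+κ) ∫F. Near a pole, F(φ)/sin φ is
compared with its value at the edge of the polar cap (`angularProfile_mul_sin_le`). Together these
give both estimates (`angularProfile_le`). -/

set_option linter.unusedSectionVars false

section

open scoped RealInnerProductSpace ENNReal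

/-! ### Bounds for the angular profile by its integral -/

section AngularProfile

variable {V : Type*} [NormedAddCommGroup V] [InnerProductSpace ℝ V] [FiniteDimensional ℝ V]
  [MeasurableSpace V] [BorelSpace V]

/-- The unnormalised density of the angle with the axis of a von Mises–Fisher direction on the unit
sphere of `ℝ × V`, with parameter `(a, q)`, where `p + 1` is the dimension of `V`. -/
noncomputable def angularProfile (ν : Measure (Metric.sphere (0 : V) 1)) (p : ℕ) (a : ℝ) (q : V)
    (φ : ℝ) : ℝ :=
  |Real.sin φ| ^ p * ∫ w, Real.exp (a * Real.cos φ + Real.sin φ * ⟪q, (w : V)⟫) ∂ν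

theorem angularProfile_nonneg (ν : Measure (Metric.sphere (0 : V) 1)) (p : ℕ) (a : ℝ) (q : V) (φ : ℝ) : 0 ≤ angularProfile ν p a q φ :=
  mul_nonneg (by positivity) (integral_nonneg fun _ => (Real.exp_pos _).le)

variable (ν : Measure (Metric.sphere (0 : V) 1)) [IsFiniteMeasure ν]

theorem continuous_angularProfile_smul (p : ℕ) (a : ℝ) (q : V) :
    Continuous fun x : ℝ × ℝ => angularProfile ν p (x.1 * a) (x.1 • q) x.2 := by
  unfold angularProfile
  refine Continuous.mul (by fun_prop) ?_
  simp_rw [← setIntegral_univ (μ := ν)]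
  refine continuous_parametric_integral_of_continuous (X := ℝ × ℝ) ?_ isCompact_univ
  simp only [Function.uncurry_def, real_inner_smul_left]
  fun_prop

theorem continuous_angularProfile (p : ℕ) (a : ℝ) (q : V) :
    Continuous (angularProfile ν p a q) := by
  have := (continuous_angularProfile_smul ν p a q).comp (Continuous.prodMk_right (1 : ℝ))
  simpa [Function.comp_def] using this

theorem integrable_exp_sphere (a : ℝ) (q : V) (φ : ℝ) :
    Integrable (fun w : Metric.sphere (0 : V) 1 =>
      Real.exp (a * Real.cos φ + Real.sin φ * ⟪q, (w : V)⟫)) ν :=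
  integrableOn_univ.mp <|
    (Continuous.continuousOn (by fun_prop)).integrableOn_compact isCompact_univ

theorem angularProfile_pos [NeZero ν] (p : ℕ) (a : ℝ) (q : V) {φ : ℝ} (h : Real.sin φ ≠ 0) :
    0 < angularProfile ν p a q φ :=
  mul_pos (by positivity) (integral_exp_pos (integrable_exp_sphere ν a q φ))

/-- Cauchy–Schwarz in ℝ × V: the exponent is the inner product of (a, q) with the unit vector (cos
φ, sin φ • w). -/
theorem abs_mul_cos_add_sin_mul_inner_le {κ a : ℝ} {q : V} (hκ : 0 ≤ κ)
    (h : a ^ 2 + ‖q‖ ^ 2 ≤ κ ^ 2) (φ : ℝ) (w : Metric.sphere (0 : V) 1) :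
    |a * Real.cos φ + Real.sin φ * ⟪q, (w : V)⟫| ≤ κ := by
  have hw : ‖(w : V)‖ = 1 := by simp
  have h1 : |⟪q, (w : V)⟫| ≤ ‖q‖ := by
    simpa [hw] using abs_real_inner_le_norm q (w : V)
  have h2 : ⟪q, (w : V)⟫ ^ 2 ≤ ‖q‖ ^ 2 := sq_le_sq' (by linarith [neg_abs_le ⟪q, (w : V)⟫])
    (by linarith [le_abs_self ⟪q, (w : V)⟫])
  refine abs_le_of_sq_le_sq ?_ hκ
  nlinarith [sq_nonneg (a * Real.sin φ - Real.cos φ * ⟪q, (w : V)⟫), Real.sin_sq_add_cos_sq φ]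

/-- Stability of `x ↦ x ^ p` under small relative perturbations. -/
theorem pow_le_two_mul_abs_sub_pow {p : ℕ} {x y : ℝ} (hx : 0 ≤ x) (hy : 0 ≤ y)
    (h : p * y ≤ x / 2) : x ^ p ≤ 2 * |x - y| ^ p := by
  rcases Nat.eq_zero_or_pos p with rfl | hp
  · norm_num
  have hp1 : (1 : ℝ) ≤ p := by exact_mod_cast hp
  have hyx : y ≤ x / 2 := by nlinarith
  rcases hx.eq_or_lt with rfl | hx
  · simp [hp.ne']
  -- Bernoulli: (1 - y/x)^p ≥ 1 - p y/x ≥ 1/2.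
  have hb := one_add_mul_le_pow (a := -(y / x)) (by
    have : y / x ≤ 1 := (div_le_one hx).2 (by linarith)
    linarith) p
  have h3 : p * (y / x) ≤ 1 / 2 := by
    rw [← mul_div_assoc, div_le_iff₀ hx]; linarith
  have h4 : |x - y| ^ p = x ^ p * (1 + -(y / x)) ^ p := by
    rw [← mul_pow, abs_of_nonneg (by linarith)]; congr 1; field_simp; ring
  rw [h4]
  nlinarith [pow_pos hx p]

/-- The inequality holds for the integrand at each w. Write H, X, Y for its values at φ, φ + δ, φ -
δ. In the product XY, `hp` limits the loss from the sines to a factor 2, and `hδ` limits the loss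
from the exponentials to another factor 2. So H² ≤ 4XY ≤ (X + Y)². -/
theorem angularProfile_le_add {p : ℕ} {κ a : ℝ} {q : V} (hκ : 0 ≤ κ)
    (h : a ^ 2 + ‖q‖ ^ 2 ≤ κ ^ 2) {φ δ : ℝ} (hp : p * δ ^ 2 ≤ Real.sin φ ^ 2 / 2)
    (hδ : κ * δ ^ 2 ≤ 1 / 4) :
    angularProfile ν p a q φ ≤ angularProfile ν p a q (φ + δ) + angularProfile ν p a q (φ - δ) := by
  unfold angularProfile
  rw [← integral_const_mul, ← integral_const_mul, ← integral_const_mul,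
    ← integral_add ((integrable_exp_sphere ν a q _).const_mul _)
      ((integrable_exp_sphere ν a q _).const_mul _)]
  refine integral_mono ((integrable_exp_sphere ν a q _).const_mul _)
    (((integrable_exp_sphere ν a q _).const_mul _).add
      ((integrable_exp_sphere ν a q _).const_mul _)) fun w => ?_
  set A : ℝ → ℝ := fun φ => a * Real.cos φ + Real.sin φ * ⟪q, (w : V)⟫ with hA
  change |Real.sin φ| ^ p * Real.exp (A φ) ≤
    |Real.sin (φ + δ)| ^ p * Real.exp (A (φ + δ)) + |Real.sin (φ - δ)| ^ p * Real.exp (A (φ - δ))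
  set X := |Real.sin (φ + δ)| ^ p * Real.exp (A (φ + δ))
  set Y := |Real.sin (φ - δ)| ^ p * Real.exp (A (φ - δ))
  set H := |Real.sin φ| ^ p * Real.exp (A φ)
  have hX : 0 ≤ X := by positivity
  have hY : 0 ≤ Y := by positivity
  have hsin : Real.sin (φ + δ) * Real.sin (φ - δ) = Real.sin φ ^ 2 - Real.sin δ ^ 2 := by
    rw [Real.sin_add, Real.sin_sub]
    linear_combination Real.sin φ ^ 2 * Real.sin_sq_add_cos_sq δ -
      Real.sin δ ^ 2 * Real.sin_sq_add_cos_sq φ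
  have hsum : A (φ + δ) + A (φ - δ) = 2 * Real.cos δ * A φ := by
    simp only [hA, Real.sin_add, Real.sin_sub, Real.cos_add, Real.cos_sub]; ring
  have hsd : Real.sin δ ^ 2 ≤ δ ^ 2 := sq_le_sq.2 Real.abs_sin_le_abs
  have hAφ : |A φ| ≤ κ := abs_mul_cos_add_sin_mul_inner_le hκ h φ w
  have hcos : 1 - Real.cos δ ≤ δ ^ 2 / 2 := by linarith [Real.one_sub_sq_div_two_le_cos (x := δ)]
  have hexp : 2 * A φ - 1 / 4 ≤ A (φ + δ) + A (φ - δ) := by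
    have h1 : (1 - Real.cos δ) * A φ ≤ (1 - Real.cos δ) * κ :=
      mul_le_mul_of_nonneg_left ((le_abs_self _).trans hAφ) (by linarith [Real.cos_le_one δ])
    have h2 : (1 - Real.cos δ) * κ ≤ δ ^ 2 / 2 * κ := mul_le_mul_of_nonneg_right hcos hκ
    rw [hsum]; linarith
  have hpow : (Real.sin φ ^ 2) ^ p ≤ 2 * |Real.sin φ ^ 2 - Real.sin δ ^ 2| ^ p :=
    pow_le_two_mul_abs_sub_pow (sq_nonneg _) (sq_nonneg _)
      ((mul_le_mul_of_nonneg_left hsd (by positivity)).trans hp)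
  have hXY : X * Y = |Real.sin φ ^ 2 - Real.sin δ ^ 2| ^ p *
      Real.exp (A (φ + δ) + A (φ - δ)) := by
    rw [← hsin, abs_mul, mul_pow, Real.exp_add]; ring
  have hH : H ^ 2 = (Real.sin φ ^ 2) ^ p * Real.exp (2 * A φ) := by
    rw [mul_pow, ← sq_abs (Real.sin φ), pow_right_comm, ← Real.exp_nat_mul]; norm_num
  have hE : Real.exp (2 * A φ) ≤ 2 * Real.exp (A (φ + δ) + A (φ - δ)) := by
    have h1 : Real.exp (2 * A φ) * Real.exp (-1 / 4) ≤ Real.exp (A (φ + δ) + A (φ - δ)) := by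
      rw [← Real.exp_add]; exact Real.exp_le_exp.2 (by linarith)
    have h2 := Real.add_one_le_exp (-1 / 4 : ℝ)
    nlinarith [Real.exp_pos (2 * A φ)]
  have hfin : H ^ 2 ≤ 4 * (X * Y) := by
    rw [hH, hXY]
    calc _ ≤ (2 * |Real.sin φ ^ 2 - Real.sin δ ^ 2| ^ p) *
          (2 * Real.exp (A (φ + δ) + A (φ - δ))) := by gcongr
      _ = _ := by ring
  refine le_of_sq_le_sq ?_ (by positivity)
  nlinarith [sq_nonneg (X - Y)]

variable {ν} in
theorem integral_comp_inner_neg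
    (hν : MeasurePreserving (fun w : Metric.sphere (0 : V) 1 => -w) ν ν) (q : V) (g : ℝ → ℝ) :
    ∫ w, g ⟪q, (w : V)⟫ ∂ν = ∫ w, g (-⟪q, (w : V)⟫) ∂ν := by
  rw [← hν.integral_comp (Homeomorph.neg (Metric.sphere (0 : V) 1)).measurableEmbedding]
  simp

/-- The sign change of sin φ is absorbed by w ↦ -w in the integral and by the absolute value outside
it. -/
theorem angularProfile_neg
    (hν : MeasurePreserving (fun w : Metric.sphere (0 : V) 1 => -w) ν ν) (p : ℕ) (a : ℝ) (q : V) (φ : ℝ) :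
    angularProfile ν p a q (-φ) = angularProfile ν p a q φ := by
  unfold angularProfile
  rw [integral_comp_inner_neg hν q fun t => Real.exp (a * Real.cos φ + Real.sin φ * t)]
  simp

theorem angularProfile_pi_sub (p : ℕ) (a : ℝ) (q : V) (φ : ℝ) :
    angularProfile ν p a q (Real.pi - φ) = angularProfile ν p (-a) q φ := by
  simp [angularProfile]

theorem angularProfile_periodic (p : ℕ) (a : ℝ) (q : V) :
    Function.Periodic (angularProfile ν p a q) (2 * Real.pi) := fun φ => by
  simp [angularProfile]

/-- Integrating the two-point inequality over δ ∈ [0, Δ] bounds the left side by the integral over a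
window around φ. Evenness and periodicity make the window harmless even if it leaves [0, π]. -/
theorem angularProfile_mul_le_integral
    (hν : MeasurePreserving (fun w : Metric.sphere (0 : V) 1 => -w) ν ν) {p : ℕ} {κ a : ℝ} {q : V} (hκ : 0 ≤ κ)
    (h : a ^ 2 + ‖q‖ ^ 2 ≤ κ ^ 2) {φ Δ : ℝ} (hΔ : 0 ≤ Δ) (hΔπ : Δ ≤ Real.pi)
    (hp : p * Δ ^ 2 ≤ Real.sin φ ^ 2 / 2) (hδ : κ * Δ ^ 2 ≤ 1 / 4) :
    Δ * angularProfile ν p a q φ ≤ 2 * ∫ ψ in 0..Real.pi, angularProfile ν p a q ψ := by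
  set F := angularProfile ν p a q with hF
  have hc : Continuous F := continuous_angularProfile ν p a q
  have hi : ∀ x y : ℝ, IntervalIntegrable F volume x y := fun x y => hc.intervalIntegrable x y
  have h0 : ∀ φ, 0 ≤ F φ := angularProfile_nonneg ν p a q
  calc Δ * F φ = ∫ _ in 0..Δ, F φ := by simp
    _ ≤ ∫ δ in 0..Δ, (F (φ + δ) + F (φ - δ)) := by
      refine intervalIntegral.integral_mono_on hΔ (by simp)
        (Continuous.intervalIntegrable (by fun_prop) _ _) fun δ hδ' => ?_
      have h1 : δ ^ 2 ≤ Δ ^ 2 := by gcongr; exacts [hδ'.1, hδ'.2]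
      exact angularProfile_le_add ν hκ h ((by gcongr : p * δ ^ 2 ≤ p * Δ ^ 2).trans hp)
        ((by gcongr : κ * δ ^ 2 ≤ κ * Δ ^ 2).trans hδ)
    _ = ∫ ψ in (φ - Δ)..(φ + Δ), F ψ := by
      rw [intervalIntegral.integral_add (Continuous.intervalIntegrable (by fun_prop) _ _)
        (Continuous.intervalIntegrable (by fun_prop) _ _),
        intervalIntegral.integral_comp_add_left, intervalIntegral.integral_comp_sub_left, add_comm,
        add_zero, sub_zero, intervalIntegral.integral_add_adjacent_intervals (hi _ _) (hi _ _)]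
    -- Since Δ ≤ π, the window fits in one full period, whose integral is twice that over [0, π].
    _ ≤ ∫ ψ in (φ - Real.pi)..(φ - Real.pi + 2 * Real.pi), F ψ := by
      refine intervalIntegral.integral_mono_interval (by linarith) (by linarith) (by linarith)
        (.of_forall h0) (hi _ _)
    _ = ∫ ψ in (-Real.pi)..(-Real.pi + 2 * Real.pi), F ψ :=
      (angularProfile_periodic ν p a q).intervalIntegral_add_eq _ _
    _ = (∫ ψ in (-Real.pi)..0, F ψ) + ∫ ψ in 0..Real.pi, F ψ := by
      rw [intervalIntegral.integral_add_adjacent_intervals (hi _ _) (hi _ _)]; congr 1; ring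
    _ = 2 * ∫ ψ in 0..Real.pi, F ψ := by
      have := intervalIntegral.integral_comp_neg (a := 0) (b := Real.pi) F
      simp only [hF, angularProfile_neg ν hν, neg_zero] at this
      rw [← hF] at this
      rw [← this]; ring

/-- Averaging over ±w replaces the exponential by an even function, which makes the integral
monotone in |sin φ|. -/
theorem angularProfile_eq_cosh
    (hν : MeasurePreserving (fun w : Metric.sphere (0 : V) 1 => -w) ν ν) (p : ℕ) (a : ℝ) (q : V)
    (φ : ℝ) : angularProfile ν p a q φ = |Real.sin φ| ^ p * (Real.exp (a * Real.cos φ) *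
      ∫ w, Real.cosh (Real.sin φ * ⟪q, (w : V)⟫) ∂ν) := by
  unfold angularProfile
  have h1 := integral_comp_inner_neg hν q fun t => Real.exp (a * Real.cos φ + Real.sin φ * t)
  have h2 : Integrable (fun w : Metric.sphere (0 : V) 1 =>
      Real.exp (a * Real.cos φ + Real.sin φ * -⟪q, (w : V)⟫)) ν := by
    simpa using integrable_exp_sphere ν a q (-φ)
  have h3 := integral_add (integrable_exp_sphere ν a q φ) h2
  rw [← h1] at h3
  congr 1
  rw [← integral_const_mul, ← mul_right_inj' (two_ne_zero (α := ℝ)), two_mul, ← h3,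
    ← integral_const_mul]
  congr 1 with w
  rw [Real.cosh_eq, Real.exp_add, Real.exp_add, mul_neg]
  ring

/-- From y ≤ exp((y² - 1)/2), the power y^(p-1) cancels the exponential up to exp((1 - y²)/2) ≤ √e ≤
2. The one factor y kept aside is what later supplies sin φ. -/
theorem pow_mul_exp_le {p : ℕ} {y t : ℝ} (hp : 1 ≤ p) (hy : 0 ≤ y)
    (ht : t ≤ p / 2 * (1 - y ^ 2)) : y ^ p * Real.exp t ≤ 2 * y := by
  obtain ⟨n, rfl⟩ := Nat.exists_eq_add_of_le' hp
  have h1 : y ≤ Real.exp ((y ^ 2 - 1) / 2) := by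
    refine le_of_sq_le_sq ?_ (Real.exp_pos _).le
    rw [← Real.exp_nat_mul]
    have := Real.add_one_le_exp (y ^ 2 - 1)
    norm_num
    rw [mul_div_cancel₀ _ two_ne_zero]
    linarith
  have h2 : y ^ n ≤ Real.exp (n * ((y ^ 2 - 1) / 2)) := by
    rw [Real.exp_nat_mul]; gcongr
  have h3 : Real.exp (n * ((y ^ 2 - 1) / 2)) * Real.exp t ≤ 2 := by
    rw [← Real.exp_add]
    calc _ ≤ Real.exp (1 / 2) := by
          refine Real.exp_le_exp.2 ?_
          push_cast at ht
          nlinarith [sq_nonneg y]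
      _ ≤ 2 := by
          refine le_of_sq_le_sq ?_ (by norm_num)
          rw [← Real.exp_nat_mul]
          have := Real.exp_one_lt_d9
          norm_num
          linarith
  calc y ^ (n + 1) * Real.exp t = y * (y ^ n * Real.exp t) := by ring
    _ ≤ y * 2 := by
      gcongr
      exact (mul_le_mul_of_nonneg_right h2 (Real.exp_pos _).le).trans h3
    _ = 2 * y := by ring

/-- Comparison inside a polar cap with edge ψ. The cosh integral grows with the sine, and `hs` makes
the cap small enough that `pow_mul_exp_le`, with y = sin φ / sin ψ, controls the change in exp(a cos
φ). -/
theorem angularProfile_mul_sin_le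
    (hν : MeasurePreserving (fun w : Metric.sphere (0 : V) 1 => -w) ν ν) {p : ℕ} {κ a : ℝ} {q : V}
    (hκ : 0 ≤ κ) (ha : |a| ≤ κ) (hp : 1 ≤ p) {φ ψ : ℝ} (h0 : 0 ≤ Real.sin φ)
    (h1 : Real.sin φ ≤ Real.sin ψ) (hψ : 0 < Real.sin ψ) (hφ : 0 ≤ Real.cos φ)
    (hc : 1 / 2 ≤ Real.cos ψ) (hs : κ * Real.sin ψ ^ 2 ≤ p / 2) :
    angularProfile ν p a q φ * Real.sin ψ ≤ 2 * angularProfile ν p a q ψ * Real.sin φ := by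
  rw [angularProfile_eq_cosh ν hν, angularProfile_eq_cosh ν hν, abs_of_nonneg h0, abs_of_pos hψ]
  have hI : ∀ φ, Integrable (fun w : Metric.sphere (0 : V) 1 =>
      Real.cosh (Real.sin φ * ⟪q, (w : V)⟫)) ν := fun φ =>
    integrableOn_univ.mp <| (Continuous.continuousOn
      (Real.continuous_cosh.comp (by fun_prop))).integrableOn_compact isCompact_univ
  have hcosh : ∫ w, Real.cosh (Real.sin φ * ⟪q, (w : V)⟫) ∂ν ≤
      ∫ w, Real.cosh (Real.sin ψ * ⟪q, (w : V)⟫) ∂ν := by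
    refine integral_mono (hI φ) (hI ψ) fun w => Real.cosh_le_cosh.2 ?_
    rw [abs_mul, abs_mul, abs_of_nonneg h0, abs_of_pos hψ]
    gcongr
  have hcs : 0 ≤ ∫ w, Real.cosh (Real.sin φ * ⟪q, (w : V)⟫) ∂ν :=
    integral_nonneg fun _ => (Real.cosh_pos _).le
  set x := Real.sin φ
  set z := Real.sin ψ
  have hy := pow_mul_exp_le (y := x / z) (t := a * Real.cos φ - a * Real.cos ψ) hp (by positivity)
    (by
      have e1 : Real.cos φ ^ 2 = 1 - x ^ 2 := Real.cos_sq' φ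
      have e2 : Real.cos ψ ^ 2 = 1 - z ^ 2 := Real.cos_sq' ψ
      have e3 : Real.cos ψ ≤ Real.cos φ := by
        refine le_of_sq_le_sq ?_ hφ
        rw [e1, e2]; gcongr
      -- The right side is (cos φ - cos ψ)(cos φ + cos ψ), and the second factor is at least 1.
      have e4 : Real.cos φ - Real.cos ψ ≤ z ^ 2 - x ^ 2 := by nlinarith
      calc a * Real.cos φ - a * Real.cos ψ = a * (Real.cos φ - Real.cos ψ) := by ring
        _ ≤ κ * (z ^ 2 - x ^ 2) :=
          mul_le_mul ((le_abs_self a).trans ha) e4 (by linarith) hκ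
        _ = κ * z ^ 2 * (1 - (x / z) ^ 2) := by field_simp
        _ ≤ p / 2 * (1 - (x / z) ^ 2) := by
          refine mul_le_mul_of_nonneg_right hs ?_
          rw [sub_nonneg, sq_le_one_iff₀ (by positivity)]
          exact (div_le_one hψ).2 h1)
  have hy' : x ^ p * z * Real.exp (a * Real.cos φ) ≤ 2 * x * (z ^ p * Real.exp (a * Real.cos ψ)) := by
    rw [Real.exp_sub, div_pow] at hy
    have e := Real.exp_pos (a * Real.cos ψ)
    have := mul_le_mul_of_nonneg_right hy (by positivity : 0 ≤ z ^ p * z * Real.exp (a * Real.cos ψ))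
    field_simp at this
    nlinarith
  calc _ = x ^ p * z * Real.exp (a * Real.cos φ) *
        ∫ w, Real.cosh (x * ⟪q, (w : V)⟫) ∂ν := by ring
    _ ≤ 2 * x * (z ^ p * Real.exp (a * Real.cos ψ)) *
        ∫ w, Real.cosh (z * ⟪q, (w : V)⟫) ∂ν := by gcongr
    _ = _ := by ring

theorem angularProfile_le_of_le_sin_sq
    (hν : MeasurePreserving (fun w : Metric.sphere (0 : V) 1 => -w) ν ν) {p : ℕ} {κ a : ℝ} {q : V}
    (hκ : 0 ≤ κ) (h : a ^ 2 + ‖q‖ ^ 2 ≤ κ ^ 2) {φ : ℝ}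
    (hφ : p / (2 * (p + 2 + κ)) ≤ Real.sin φ ^ 2) :
    angularProfile ν p a q φ ≤
      4 * √(p + 2 + κ) * ∫ ψ in 0..Real.pi, angularProfile ν p a q ψ := by
  have hp0 : (0 : ℝ) ≤ p := p.cast_nonneg
  set D := (p : ℝ) + 2 + κ with hD
  have hD0 : 2 ≤ D := by linarith
  have hs : √D ^ 2 = D := Real.sq_sqrt (by linarith)
  have hs1 : 1 ≤ √D := Real.one_le_sqrt.2 (by linarith)
  have hΔ : (1 / (2 * √D)) ^ 2 = 1 / (4 * D) := by rw [div_pow, mul_pow, hs]; norm_num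
  -- With Δ² = 1/(4D), pΔ² is exactly half the threshold in `hφ`, and κΔ² ≤ 1/4 because κ ≤ D.
  have := angularProfile_mul_le_integral ν hν hκ h (φ := φ) (Δ := 1 / (2 * √D)) (by positivity)
    (by
      refine le_trans ?_ Real.two_le_pi
      rw [div_le_iff₀ (by positivity)]; linarith)
    (by
      rw [hΔ]; refine le_trans (le_of_eq ?_) (div_le_div_of_nonneg_right hφ two_pos.le)
      field_simp; norm_num)
    (by
      rw [hΔ, mul_one_div, div_le_iff₀ (by positivity)]; linarith)
  rw [one_div_mul_eq_div, div_le_iff₀ (by positivity)] at this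
  linarith

/-- Away from the poles this is the averaging bound. Inside a cap it is that bound at the edge of
the cap, transported inwards with a factor 2. -/
theorem angularProfile_le
    (hν : MeasurePreserving (fun w : Metric.sphere (0 : V) 1 => -w) ν ν) {p : ℕ} {κ a : ℝ} {q : V}
    (hκ : 0 ≤ κ) (h : a ^ 2 + ‖q‖ ^ 2 ≤ κ ^ 2) {φ : ℝ} (hφ : φ ∈ Icc 0 Real.pi) :
    angularProfile ν p a q φ ≤
        8 * √(p + 2 + κ) * ∫ ψ in 0..Real.pi, angularProfile ν p a q ψ ∧
      (1 ≤ p → angularProfile ν p a q φ * √(p / (2 * (p + 2 + κ))) ≤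
        8 * √(p + 2 + κ) * (∫ ψ in 0..Real.pi, angularProfile ν p a q ψ) * Real.sin φ) := by
  have hp0 : (0 : ℝ) ≤ p := p.cast_nonneg
  -- The reflection φ ↦ π - φ only changes the sign of a and preserves the integral.
  wlog hcos : 0 ≤ Real.cos φ generalizing a φ
  · have hφ' : Real.pi - φ ∈ Icc 0 Real.pi := ⟨by linarith [hφ.2], by linarith [hφ.1]⟩
    have := this (a := -a) (φ := Real.pi - φ) (by simpa using h) hφ'
      (by rw [Real.cos_pi_sub]; linarith)
    have hZ : ∫ ψ in 0..Real.pi, angularProfile ν p (-a) q ψ =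
        ∫ ψ in 0..Real.pi, angularProfile ν p a q ψ := by
      simp_rw [← angularProfile_pi_sub]
      rw [intervalIntegral.integral_comp_sub_left]; simp
    simpa only [angularProfile_pi_sub, neg_neg, hZ, Real.sin_pi_sub] using this
  set Z := ∫ ψ in 0..Real.pi, angularProfile ν p a q ψ
  have hZ : 0 ≤ Z := intervalIntegral.integral_nonneg Real.pi_pos.le fun _ _ =>
    angularProfile_nonneg ν p a q _
  have hF0 := angularProfile_nonneg ν p a q φ
  have hsin : 0 ≤ Real.sin φ := Real.sin_nonneg_of_mem_Icc hφ
  have hDZ : 0 ≤ √(p + 2 + κ) * Z := by positivity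
  have hx0 : 0 ≤ p / (2 * (p + 2 + κ)) := by positivity
  rcases le_or_gt (p / (2 * (p + 2 + κ))) (Real.sin φ ^ 2) with hc | hc
  · have h1 := angularProfile_le_of_le_sin_sq ν hν hκ h hc
    refine ⟨by linarith, fun _ => mul_le_mul (by linarith) ?_ (Real.sqrt_nonneg _) (by linarith)⟩
    exact (Real.sqrt_le_left hsin).2 hc
  -- For p = 0 the threshold is 0, so there is no polar cap.
  · have hp : 1 ≤ p := by
      rcases Nat.eq_zero_or_pos p with rfl | hp
      · simp only [Nat.cast_zero, zero_div] at hc; nlinarith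
      · exact hp
    have hp1 : (1 : ℝ) ≤ p := by exact_mod_cast hp
    have hx1 : p / (2 * (p + 2 + κ)) ≤ 1 / 2 := by
      rw [div_le_div_iff₀ (by positivity) two_pos]; linarith
    set x := √(p / (2 * (p + 2 + κ))) with hx
    have hxs : x ^ 2 = p / (2 * (p + 2 + κ)) := Real.sq_sqrt hx0
    have hxpos : 0 < x := Real.sqrt_pos.2 (by positivity)
    have hx_le : x ≤ 1 := Real.sqrt_le_one.2 (by linarith)
    have hsx : Real.sin φ ≤ x := Real.le_sqrt_of_sq_le hc.le
    have hψ : Real.sin (Real.arcsin x) = x := Real.sin_arcsin (by linarith) hx_le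
    have ha : |a| ≤ κ := abs_le_of_sq_le_sq (by nlinarith [sq_nonneg ‖q‖]) hκ
    have h2 := angularProfile_mul_sin_le ν hν (q := q) hκ ha hp hsin (ψ := Real.arcsin x)
      (by rwa [hψ]) (by rwa [hψ]) hcos
      (by
        rw [Real.cos_arcsin]; refine Real.le_sqrt_of_sq_le ?_
        rw [hxs]; linarith)
      (by
        rw [hψ, hxs, ← mul_div_assoc, div_le_div_iff₀ (by positivity) two_pos]
        nlinarith)
    have h3 := angularProfile_le_of_le_sin_sq ν hν hκ h (φ := Real.arcsin x) (by rw [hψ, hxs])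
    rw [hψ] at h2
    have h4 : angularProfile ν p a q φ * x ≤ 8 * √(p + 2 + κ) * Z * Real.sin φ :=
      h2.trans (mul_le_mul_of_nonneg_right (by linarith) hsin)
    refine ⟨le_of_mul_le_mul_right (h4.trans ?_) hxpos, fun _ => h4⟩
    exact mul_le_mul_of_nonneg_left hsx (by linarith)

theorem angularProfile_le_sqrt
    (hν : MeasurePreserving (fun w : Metric.sphere (0 : V) 1 => -w) ν ν) {p : ℕ} {κ a : ℝ} {q : V}
    (hκ : 0 ≤ κ) (h : a ^ 2 + ‖q‖ ^ 2 ≤ κ ^ 2) {φ : ℝ} (hφ : φ ∈ Icc 0 Real.pi) :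
    angularProfile ν p a q φ ≤
        20 * (√(p + 2) + √κ) * ∫ ψ in 0..Real.pi, angularProfile ν p a q ψ := by
  refine (angularProfile_le ν hν hκ h hφ).1.trans ?_
  have hZ : 0 ≤ ∫ ψ in 0..Real.pi, angularProfile ν p a q ψ :=
    intervalIntegral.integral_nonneg Real.pi_pos.le fun _ _ => angularProfile_nonneg ν p a q _
  refine mul_le_mul_of_nonneg_right ?_ hZ
  have : √((p : ℝ) + 2 + κ) ≤ √(p + 2) + √κ := by
    refine Real.sqrt_le_iff.2 ⟨by positivity, ?_⟩
    nlinarith [Real.sq_sqrt hκ, Real.sq_sqrt (by positivity : 0 ≤ (p : ℝ) + 2),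
      mul_nonneg (Real.sqrt_nonneg ((p : ℝ) + 2)) (Real.sqrt_nonneg κ)]
  nlinarith [Real.sqrt_nonneg ((p : ℝ) + 2 + κ)]

/-- With D = p + 2 + κ, dividing √D by √(p/(2D)) gives D√(2/p). For p ≥ 1 this is of order D/√(p+2)
= √(p+2) + κ/√(p+2). -/
theorem angularProfile_le_mul_sin
    (hν : MeasurePreserving (fun w : Metric.sphere (0 : V) 1 => -w) ν ν) {p : ℕ} {κ a : ℝ} {q : V}
    (hκ : 0 ≤ κ) (h : a ^ 2 + ‖q‖ ^ 2 ≤ κ ^ 2) (hp : 1 ≤ p) {φ : ℝ} (hφ : φ ∈ Icc 0 Real.pi) :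
    angularProfile ν p a q φ ≤ 20 * (√(p + 2) + κ / √(p + 2)) *
      (∫ ψ in 0..Real.pi, angularProfile ν p a q ψ) * Real.sin φ := by
  have hp1 : (1 : ℝ) ≤ p := by exact_mod_cast hp
  have h1 := (angularProfile_le ν hν hκ h hφ).2 hp
  have hZ : 0 ≤ ∫ ψ in 0..Real.pi, angularProfile ν p a q ψ :=
    intervalIntegral.integral_nonneg Real.pi_pos.le fun _ _ => angularProfile_nonneg ν p a q _
  have hsin : 0 ≤ Real.sin φ := Real.sin_nonneg_of_mem_Icc hφ
  have hx : 0 < √((p : ℝ) / (2 * (p + 2 + κ))) := Real.sqrt_pos.2 (by positivity)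
  refine le_of_mul_le_mul_right (h1.trans ?_) hx
  have key : 8 * √(p + 2 + κ) ≤
      20 * (√(p + 2) + κ / √(p + 2)) * √((p : ℝ) / (2 * (p + 2 + κ))) := by
    have hd : 0 < √((p : ℝ) + 2) := Real.sqrt_pos.2 (by positivity)
    have e1 : √((p : ℝ) + 2) + κ / √(p + 2) = (p + 2 + κ) / √(p + 2) := by
      field_simp; rw [Real.sq_sqrt (by positivity)]
    refine le_of_sq_le_sq ?_ (by positivity)
    rw [e1, mul_pow, mul_pow, mul_pow, div_pow, Real.sq_sqrt (by positivity),
      Real.sq_sqrt (by positivity), Real.sq_sqrt (by positivity)]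
    rw [show (20 : ℝ) ^ 2 * ((p + 2 + κ) ^ 2 / (p + 2)) * (p / (2 * (p + 2 + κ))) =
      (200 * p / (p + 2)) * (p + 2 + κ) by field_simp; norm_num]
    -- After squaring, the constant 20 suffices because 64(p + 2) ≤ 200p for p ≥ 1.
    refine mul_le_mul_of_nonneg_right ?_ (by positivity)
    rw [le_div_iff₀ (by positivity)]; linarith
  calc _ = 8 * √(p + 2 + κ) *
        ((∫ ψ in 0..Real.pi, angularProfile ν p a q ψ) * Real.sin φ) := by ring
    _ ≤ _ := mul_le_mul_of_nonneg_right key (by positivity)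
    _ = _ := by ring

end AngularProfile

-- The surface measure of s is computed from the cone over s, and the cone over -s is the negative
-- of that cone.
open scoped Pointwise in
theorem measurePreserving_neg_toSphere {V : Type*} [NormedAddCommGroup V] [NormedSpace ℝ V]
    [MeasurableSpace V] [BorelSpace V] (μ : Measure V) [μ.IsNegInvariant] :
    MeasurePreserving (fun w : Metric.sphere (0 : V) 1 => -w) μ.toSphere μ.toSphere := by
  have hm : Measurable fun w : Metric.sphere (0 : V) 1 => -w := continuous_neg.measurable
  refine ⟨hm, Measure.ext fun s hs => ?_⟩
  rw [Measure.map_apply hm hs, Measure.toSphere_apply' _ hs, Measure.toSphere_apply' _ (hm hs),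
    ← Measure.measure_neg μ (Ioo (0 : ℝ) 1 • _)]
  congr 2
  ext x
  simp only [Set.mem_smul, Set.mem_neg, Set.mem_image, Set.mem_preimage]
  constructor
  · rintro ⟨t, ht, _, ⟨w, hw, rfl⟩, h⟩
    exact ⟨t, ht, _, ⟨-w, hw, rfl⟩, by simpa using congrArg Neg.neg h⟩
  · rintro ⟨t, ht, _, ⟨w, hw, rfl⟩, h⟩
    exact ⟨t, ht, _, ⟨-w, by simpa using hw, rfl⟩, by simp [h]⟩

/-! ### Spherical coordinates around an axis -/

section Polar

theorem lintegral_eq_lintegral_toSphere {V : Type*} [NormedAddCommGroup V] [NormedSpace ℝ V]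
    [MeasurableSpace V] [BorelSpace V] [FiniteDimensional ℝ V] [Nontrivial V] (μ : Measure V)
    [μ.IsAddHaarMeasure] {h : V → ℝ≥0∞} (hh : Measurable h) :
    ∫⁻ k, h k ∂μ = ∫⁻ w, (∫⁻ ρ in Ioi (0 : ℝ),
      ENNReal.ofReal (ρ ^ (Module.finrank ℝ V - 1)) * h (ρ • (w : V))) ∂μ.toSphere := by
  calc ∫⁻ k, h k ∂μ = ∫⁻ k : ({(0 : V)}ᶜ : Set V), h k ∂(μ.comap (↑)) := by
        rw [lintegral_subtype_comap (measurableSet_singleton _).compl, restrict_compl_singleton]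
    _ = ∫⁻ x : Metric.sphere (0 : V) 1 × Ioi (0 : ℝ), h (x.2.1 • (x.1 : V))
          ∂(μ.toSphere.prod (.volumeIoiPow (Module.finrank ℝ V - 1))) := by
        rw [← μ.measurePreserving_homeomorphUnitSphereProd.lintegral_comp_emb
          (Homeomorph.measurableEmbedding _)]
        refine lintegral_congr fun x => ?_
        rw [← homeomorphUnitSphereProd_symm_apply_coe, Homeomorph.symm_apply_apply]
    _ = ∫⁻ w, ∫⁻ ρ : Ioi (0 : ℝ), h (ρ.1 • (w : V))
          ∂(.volumeIoiPow (Module.finrank ℝ V - 1)) ∂μ.toSphere := by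
        rw [lintegral_prod]
        exact Measurable.aemeasurable (by fun_prop)
    _ = _ := by
        refine lintegral_congr fun w => ?_
        rw [Measure.volumeIoiPow, lintegral_withDensity_eq_lintegral_mul _ (by fun_prop)
          (by fun_prop), ← lintegral_subtype_comap measurableSet_Ioi]
        rfl

variable {E : Type*} [NormedAddCommGroup E] [InnerProductSpace ℝ E] [FiniteDimensional ℝ E]
  [MeasurableSpace E] [BorelSpace E]

theorem lintegral_eq_lintegral_span_orthogonal {u : E} (hu : ‖u‖ = 1) {g : E → ℝ≥0∞}
    (hg : Measurable g) :
    ∫⁻ z, g z = ∫⁻ t : ℝ, ∫⁻ k : (ℝ ∙ u)ᗮ, g (t • u + k) := by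
  let e := LinearIsometryEquiv.toSpanUnitSingleton (𝕜 := ℝ) u hu
  have h1 : MeasurePreserving (Prod.map e (id : (ℝ ∙ u)ᗮ → (ℝ ∙ u)ᗮ))
      (volume.prod volume) (volume.prod volume) :=
    e.measurePreserving.prod (MeasurePreserving.id _)
  have h2 := WithLp.volume_preserving_toLp (ℝ ∙ u) (ℝ ∙ u)ᗮ
  have h3 := (ℝ ∙ u).orthogonalDecomposition.symm.measurePreserving
  have h4 := h3.comp (h2.comp h1)
  rw [← h4.lintegral_comp hg, lintegral_prod]
  · simp [e]
  · exact (hg.comp h4.measurable).aemeasurable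

/-- Planar polar coordinates applied to f cut off to the upper half plane: the cutoff removes the
angles in (-π, 0]. -/
theorem lintegral_upper_half_plane_eq_polar {f : ℝ × ℝ → ℝ≥0∞} (hf : Measurable f) :
    ∫⁻ t : ℝ, ∫⁻ ρ in Ioi (0 : ℝ), f (t, ρ) = ∫⁻ r in Ioi (0 : ℝ), ∫⁻ φ in Ioo 0 Real.pi,
      ENNReal.ofReal r * f (r * Real.cos φ, r * Real.sin φ) := by
  have hS : MeasurableSet {p : ℝ × ℝ | 0 < p.2} := measurableSet_lt (by fun_prop) (by fun_prop)
  have h1 : ∫⁻ t : ℝ, ∫⁻ ρ in Ioi (0 : ℝ), f (t, ρ) =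
      ∫⁻ p : ℝ × ℝ, {p : ℝ × ℝ | 0 < p.2}.indicator f p := by
    rw [Measure.volume_eq_prod, lintegral_prod _ (hf.indicator hS).aemeasurable]
    refine lintegral_congr fun t => ?_
    rw [← lintegral_indicator measurableSet_Ioi]
    rfl
  rw [h1, ← lintegral_comp_polarCoord_symm, polarCoord_target, Measure.volume_eq_prod,
    ← Measure.prod_restrict, lintegral_prod]
  · refine setLIntegral_congr_fun measurableSet_Ioi fun r (hr : 0 < r) => ?_
    rw [← lintegral_indicator measurableSet_Ioo, ← lintegral_indicator measurableSet_Ioo]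
    refine lintegral_congr fun φ => ?_
    simp only [indicator, polarCoord_symm_apply, mem_ofPred_eq, smul_eq_mul, mem_Ioo]
    by_cases h : 0 < φ ∧ φ < Real.pi
    · have := Real.sin_pos_of_pos_of_lt_pi h.1 h.2
      rw [if_pos ⟨by linarith, h.2⟩, if_pos (by positivity), if_pos h]
    · rw [if_neg h]
      split_ifs with h2 h3
      · exfalso
        have h4 : φ ≤ 0 := by
          by_contra! h5
          exact h ⟨h5, h2.2⟩
        have := Real.sin_nonpos_of_nonpos_of_neg_pi_le h4 h2.1.le
        nlinarith
      · simp
      · rfl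
  · have : Measurable fun p : ℝ × ℝ => polarCoord.symm p := continuous_polarCoord_symm.measurable
    exact (Measurable.smul (f := fun p : ℝ × ℝ => ENNReal.ofReal p.1) (by fun_prop)
      ((hf.indicator hS).comp this)).aemeasurable

/-- Integration in spherical coordinates adapted to the axis spanned by the unit vector `u`. -/
theorem lintegral_eq_lintegral_polar_axis {u : E} (hu : ‖u‖ = 1) {p : ℕ}
    (hp : Module.finrank ℝ (ℝ ∙ u)ᗮ = p + 1) {g : E → ℝ≥0∞} (hg : Measurable g) :
    ∫⁻ z, g z = ∫⁻ w : Metric.sphere (0 : (ℝ ∙ u)ᗮ) 1, (∫⁻ r in Ioi (0 : ℝ),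
      ∫⁻ φ in Ioo 0 Real.pi, ENNReal.ofReal r * (ENNReal.ofReal ((r * Real.sin φ) ^ p) *
        g ((r * Real.cos φ) • u + (r * Real.sin φ) • ((w : (ℝ ∙ u)ᗮ) : E))))
        ∂(volume : Measure (ℝ ∙ u)ᗮ).toSphere := by
  have : Nontrivial (ℝ ∙ u)ᗮ := Module.nontrivial_of_finrank_pos (R := ℝ) (by omega)
  rw [lintegral_eq_lintegral_span_orthogonal hu hg]
  have h1 : ∀ t : ℝ, ∫⁻ k : (ℝ ∙ u)ᗮ, g (t • u + k) =
      ∫⁻ w : Metric.sphere (0 : (ℝ ∙ u)ᗮ) 1, (∫⁻ ρ in Ioi (0 : ℝ),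
        ENNReal.ofReal (ρ ^ p) * g (t • u + ρ • ((w : (ℝ ∙ u)ᗮ) : E)))
        ∂(volume : Measure (ℝ ∙ u)ᗮ).toSphere := fun t => by
    rw [lintegral_eq_lintegral_toSphere volume (by fun_prop), hp]
    rfl
  simp_rw [h1]
  rw [lintegral_lintegral_swap]
  · refine lintegral_congr fun w => ?_
    exact lintegral_upper_half_plane_eq_polar
      (f := fun x => ENNReal.ofReal (x.2 ^ p) * g (x.1 • u + x.2 • ((w : (ℝ ∙ u)ᗮ) : E)))
      (by fun_prop)
  · refine Measurable.aemeasurable ?_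
    simp only [Function.uncurry_def]
    refine Measurable.lintegral_prod_right'
      (f := fun x : (ℝ × Metric.sphere (0 : (ℝ ∙ u)ᗮ) 1) × ℝ =>
        ENNReal.ofReal (x.2 ^ p) * g (x.1.1 • u + x.2 • ((x.1.2 : (ℝ ∙ u)ᗮ) : E))) ?_
    fun_prop

end Polar

/-! ### Lebesgue density of the isotropic Gaussian -/

section Gaussian

/-- Both sides are finite measures with the same characteristic function. -/
theorem multivariateGaussian_smul_one_eq_withDensity {ι : Type*} [Fintype ι] [DecidableEq ι]
    (μ : EuclideanSpace ℝ ι) {σ : ℝ} (hσ : 0 < σ) :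
    multivariateGaussian μ (σ ^ 2 • (1 : Matrix ι ι ℝ)) =
      volume.withDensity fun y => ENNReal.ofReal
        ((Real.pi * (2 * σ ^ 2)) ^ (-(Fintype.card ι / 2 : ℝ)) *
          Real.exp (-(1 / (2 * σ ^ 2)) * ‖y - μ‖ ^ 2)) := by
  set b : ℝ := 1 / (2 * σ ^ 2) with hb
  have hb0 : 0 < b := by positivity
  have hbπ : Real.pi * (2 * σ ^ 2) = Real.pi / b := by rw [hb]; field_simp
  rw [hbπ]
  set c : ℝ := (Real.pi / b) ^ (-(Fintype.card ι / 2 : ℝ)) with hc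
  have hc0 : 0 < c := by positivity
  have hint : Integrable fun y : EuclideanSpace ℝ ι => Real.exp (-b * ‖y‖ ^ 2) := by
    -- A non-integrable function would have integral 0, contradicting the positive value of the
    -- Gaussian integral.
    by_contra h
    have := GaussianFourier.integral_rexp_neg_mul_sq_norm (V := EuclideanSpace ℝ ι) hb0
    rw [integral_undef h] at this
    have : 0 < (Real.pi / b) ^ (Module.finrank ℝ (EuclideanSpace ℝ ι) / 2 : ℝ) := by positivity
    linarith
  have hint' : Integrable fun y : EuclideanSpace ℝ ι => c * Real.exp (-b * ‖y - μ‖ ^ 2) :=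
    (hint.comp_sub_right μ).const_mul c
  have : IsFiniteMeasure (volume.withDensity fun y : EuclideanSpace ℝ ι =>
      ENNReal.ofReal (c * Real.exp (-b * ‖y - μ‖ ^ 2))) :=
    isFiniteMeasure_withDensity_ofReal hint'.2
  have hS : (σ ^ 2 • (1 : Matrix ι ι ℝ)).PosSemidef := Matrix.PosSemidef.one.smul (by positivity)
  refine Measure.ext_of_charFun (funext fun t => ?_)
  rw [charFun_multivariateGaussian hS, charFun_apply]
  rw [integral_withDensity_eq_integral_toReal_smul (by fun_prop) (by simp)]
  have hfc := GaussianFourier.integral_cexp_neg_mul_sq_norm_add (b := (b : ℂ)) (by simpa using hb0)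
    Complex.I t
  rw [← integral_sub_right_eq_self _ μ] at hfc
  have h1 : ∀ y : EuclideanSpace ℝ ι,
      (ENNReal.ofReal (c * Real.exp (-b * ‖y - μ‖ ^ 2))).toReal • Complex.exp (⟪y, t⟫ * Complex.I) =
      (c * Complex.exp (⟪t, μ⟫ * Complex.I)) *
        Complex.exp (-(b : ℂ) * (‖y - μ‖ : ℂ) ^ 2 + Complex.I * ⟪t, y - μ⟫) := fun y => by
    rw [ENNReal.toReal_ofReal (by positivity), Complex.real_smul, mul_assoc, ← Complex.exp_add,
      Complex.ofReal_mul, mul_assoc, Complex.ofReal_exp, ← Complex.exp_add, inner_sub_right,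
      real_inner_comm t y]
    congr 2
    push_cast
    ring
  simp_rw [h1]
  rw [integral_const_mul]
  rw [hfc]
  have h2 : ((Real.pi : ℂ) / b) ^ (Module.finrank ℝ (EuclideanSpace ℝ ι) / 2 : ℂ) = (c : ℂ)⁻¹ := by
    rw [hc, Real.rpow_neg (by positivity), Complex.ofReal_inv, inv_inv,
      Complex.ofReal_cpow (by positivity)]
    simp
  have hcC : (c : ℂ) ≠ 0 := by exact_mod_cast hc0.ne'
  rw [h2, mul_mul_mul_comm, mul_inv_cancel₀ hcC, one_mul, ← Complex.exp_add]
  congr 1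
  have h3 : t.ofLp ⬝ᵥ (σ ^ 2 • (1 : Matrix ι ι ℝ)).mulVec t.ofLp = σ ^ 2 * ‖t‖ ^ 2 := by
    rw [Matrix.smul_mulVec, Matrix.one_mulVec, dotProduct_smul, EuclideanSpace.real_norm_sq_eq]
    simp [dotProduct, sq]
  have hσC : (σ : ℂ) ≠ 0 := by exact_mod_cast hσ.ne'
  rw [h3, hb, Complex.I_sq]
  push_cast
  field_simp
  ring

end Gaussian

/-! ### Existence and uniqueness of the continuous conditional density -/

section Conditioning

variable {Ω : Type*} [MeasurableSpace Ω] {P : Measure Ω} {Φ R : Ω → ℝ} {F : ℝ → ℝ → ℝ} {w : ℝ → ℝ}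

/-- The joint law of `(R, Φ)` has density `w r * F r φ` on `(0, ∞) × [0, π]`. -/
def HasPolarJointDensity (P : Measure Ω) (Φ R : Ω → ℝ) (w : ℝ → ℝ) (F : ℝ → ℝ → ℝ) : Prop :=
  ∀ A B : Set ℝ, MeasurableSet A → MeasurableSet B →
    P {ω | R ω ∈ B ∧ Φ ω ∈ A} =
      ∫⁻ r in B ∩ Ioi 0, ∫⁻ φ in A ∩ Icc 0 Real.pi, ENNReal.ofReal (w r * F r φ)

theorem map_eq_withDensity_of_hasPolarJointDensity (hR : AEMeasurable R P)
    (hJ : HasPolarJointDensity P Φ R w F) (hF : Continuous fun x : ℝ × ℝ => F x.1 x.2)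
    (hF0 : ∀ r φ, 0 ≤ F r φ) (hw : ∀ r, 0 < r → 0 < w r) :
    P.map R = (volume.restrict (Ioi 0)).withDensity
      fun r => ENNReal.ofReal (w r * ∫ φ in 0..Real.pi, F r φ) := by
  refine Measure.ext fun B hB => ?_
  have h1 := hJ univ B .univ hB
  simp only [mem_univ, and_true, univ_inter] at h1
  rw [Measure.map_apply_of_aemeasurable hR hB, withDensity_apply _ hB,
    Measure.restrict_restrict hB]
  refine h1.trans (setLIntegral_congr_fun (hB.inter measurableSet_Ioi) fun r hr => ?_)
  have hc : Continuous fun φ => w r * F r φ :=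
    continuous_const.mul (hF.comp (Continuous.prodMk_right r))
  rw [← intervalIntegral.integral_const_mul, intervalIntegral.integral_of_le Real.pi_pos.le,
    ← integral_Icc_eq_integral_Ioc, ofReal_integral_eq_lintegral_ofReal
      (hc.continuousOn.integrableOn_compact isCompact_Icc)
      (.of_forall fun φ => mul_nonneg (hw r hr.2).le (hF0 r φ))]

/-- The radial weight cancels: the joint density w F is the radial density w ∫F times F/∫F. -/
theorem isCondAngleDensity_of_hasPolarJointDensity (hR : AEMeasurable R P)
    (hJ : HasPolarJointDensity P Φ R w F) (hF : Continuous fun x : ℝ × ℝ => F x.1 x.2)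
    (hF0 : ∀ r φ, 0 ≤ F r φ) (hZ : ∀ r, 0 < ∫ φ in 0..Real.pi, F r φ) (hwc : Continuous w)
    (hw : ∀ r, 0 < r → 0 < w r) :
    IsCondAngleDensity P Φ R fun r φ => F r φ / ∫ ψ in 0..Real.pi, F r ψ := by
  have hZc : Continuous fun r => ∫ φ in 0..Real.pi, F r φ :=
    intervalIntegral.continuous_parametric_intervalIntegral_of_continuous' hF _ _
  have hfc : Continuous fun x : ℝ × ℝ => F x.1 x.2 / ∫ ψ in 0..Real.pi, F x.1 ψ :=
    hF.div (hZc.comp continuous_fst) fun x => (hZ x.1).ne'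
  refine ⟨hfc.continuousOn, fun r _ φ _ => div_nonneg (hF0 r φ) (hZ r).le, fun r _ => ?_,
    fun A B hA hB => ?_⟩
  · rw [integral_div, integral_Icc_eq_integral_Ioc,
      ← intervalIntegral.integral_of_le Real.pi_pos.le, div_self (hZ r).ne']
  · rw [hJ A B hA hB, map_eq_withDensity_of_hasPolarJointDensity hR hJ hF hF0 hw,
      restrict_withDensity hB, Measure.restrict_restrict hB,
      lintegral_withDensity_eq_lintegral_mul _ (by fun_prop)]
    · refine setLIntegral_congr_fun (hB.inter measurableSet_Ioi) fun r hr => ?_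
      dsimp only [Pi.mul_apply]
      rw [← lintegral_const_mul _ (by
        have : Continuous fun φ => F r φ / ∫ ψ in 0..Real.pi, F r ψ :=
          hfc.comp (Continuous.prodMk_right r)
        fun_prop)]
      refine lintegral_congr fun φ => ?_
      rw [← ENNReal.ofReal_mul (mul_pos (hw r hr.2) (hZ r)).le, mul_assoc,
        mul_div_cancel₀ _ (hZ r).ne']
    · exact Measurable.lintegral_prod_right'
        (f := fun x : ℝ × ℝ => ENNReal.ofReal (F x.1 x.2 / ∫ ψ in 0..Real.pi, F x.1 ψ))
        (by fun_prop)

/-- Turns a disintegration into a planar measure with known values on rectangles, so that two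
disintegrations can be compared. -/
theorem withDensity_apply_prod_of_isCondAngleDensity {g : ℝ → ℝ} (hg : Continuous g)
    (hP : P.map R = (volume.restrict (Ioi 0)).withDensity fun r => ENNReal.ofReal (g r))
    {f : ℝ → ℝ → ℝ} (hf : IsCondAngleDensity P Φ R f) {A B : Set ℝ} (hA : MeasurableSet A)
    (hB : MeasurableSet B) :
    ((volume.restrict (Ioi 0 ×ˢ Icc 0 Real.pi)).withDensity fun x : ℝ × ℝ =>
      ENNReal.ofReal (g x.1) * ENNReal.ofReal (f x.1 x.2)) (B ×ˢ A) =
        P {ω | R ω ∈ B ∧ Φ ω ∈ A} := by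
  have hm : AEMeasurable (fun x : ℝ × ℝ => ENNReal.ofReal (f x.1 x.2))
      (volume.restrict (Ioi 0 ×ˢ Icc 0 Real.pi)) :=
    (hf.continuousOn.aemeasurable (measurableSet_Ioi.prod measurableSet_Icc)).ennreal_ofReal
  have hsub : (B ×ˢ A) ∩ (Ioi 0 ×ˢ Icc 0 Real.pi) = (B ∩ Ioi 0) ×ˢ (A ∩ Icc 0 Real.pi) :=
    prod_inter_prod
  have hm' : AEMeasurable (fun x : ℝ × ℝ => ENNReal.ofReal (f x.1 x.2))
      ((volume.restrict (B ∩ Ioi 0)).prod (volume.restrict (A ∩ Icc 0 Real.pi))) := by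
    rw [Measure.prod_restrict]
    exact hm.mono_measure (Measure.restrict_mono (prod_mono inter_subset_right inter_subset_right)
      le_rfl)
  have hgm : AEMeasurable (fun x : ℝ × ℝ => ENNReal.ofReal (g x.1) * ENNReal.ofReal (f x.1 x.2))
      ((volume.restrict (B ∩ Ioi 0)).prod (volume.restrict (A ∩ Icc 0 Real.pi))) :=
    AEMeasurable.mul (by fun_prop) hm'
  rw [hf.disintegration A B hA hB, hP, withDensity_apply _ (hB.prod hA),
    Measure.restrict_restrict (hB.prod hA), hsub, Measure.volume_eq_prod, ← Measure.prod_restrict,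
    lintegral_prod _ hgm, restrict_withDensity hB,
    Measure.restrict_restrict hB, lintegral_withDensity_eq_lintegral_mul₀ (by fun_prop)]
  · refine setLIntegral_congr_fun (hB.inter measurableSet_Ioi) fun r hr => ?_
    dsimp only [Pi.mul_apply]
    rw [lintegral_const_mul' _ _ ENNReal.ofReal_ne_top]
  · exact hm'.lintegral_prod_right'

/-- Both planar measures agree on rectangles, hence their densities agree almost everywhere.
Cancelling g > 0 and using continuity gives equality everywhere, since the domain lies in the
closure of its interior. -/
theorem IsCondAngleDensity.eqOn [IsFiniteMeasure P] {g : ℝ → ℝ} (hg : Continuous g)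
    (hg0 : ∀ r, 0 < r → 0 < g r)
    (hP : P.map R = (volume.restrict (Ioi 0)).withDensity fun r => ENNReal.ofReal (g r))
    {f₁ f₂ : ℝ → ℝ → ℝ} (h₁ : IsCondAngleDensity P Φ R f₁) (h₂ : IsCondAngleDensity P Φ R f₂) :
    EqOn (fun x : ℝ × ℝ => f₁ x.1 x.2) (fun x => f₂ x.1 x.2) (Ioi 0 ×ˢ Icc 0 Real.pi) := by
  have hS : MeasurableSet (Ioi (0 : ℝ) ×ˢ Icc 0 Real.pi) := measurableSet_Ioi.prod measurableSet_Icc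
  have hfin : ∀ {f}, IsCondAngleDensity P Φ R f →
      ((volume.restrict (Ioi 0 ×ˢ Icc 0 Real.pi)).withDensity fun x : ℝ × ℝ =>
        ENNReal.ofReal (g x.1) * ENNReal.ofReal (f x.1 x.2)) univ ≠ ∞ := fun hf => by
    rw [← univ_prod_univ, withDensity_apply_prod_of_isCondAngleDensity hg hP hf .univ .univ]
    exact measure_ne_top _ _
  have hm : ∀ {f}, IsCondAngleDensity P Φ R f →
      AEMeasurable (fun x : ℝ × ℝ => ENNReal.ofReal (g x.1) * ENNReal.ofReal (f x.1 x.2))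
        (volume.restrict (Ioi 0 ×ˢ Icc 0 Real.pi)) := fun hf =>
    AEMeasurable.mul (by fun_prop) (hf.continuousOn.aemeasurable hS).ennreal_ofReal
  have : IsFiniteMeasure ((volume.restrict (Ioi 0 ×ˢ Icc 0 Real.pi)).withDensity
      fun x : ℝ × ℝ => ENNReal.ofReal (g x.1) * ENNReal.ofReal (f₁ x.1 x.2)) :=
    ⟨(hfin h₁).lt_top⟩
  have hae := (withDensity_eq_iff (hm h₁) (hm h₂) (by
    simpa [withDensity_apply] using hfin h₁)).1 (Measure.ext_prod fun {B A} hB hA => by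
      rw [withDensity_apply_prod_of_isCondAngleDensity hg hP h₁ hA hB,
        withDensity_apply_prod_of_isCondAngleDensity hg hP h₂ hA hB])
  refine Measure.eqOn_of_ae_eq (μ := volume) ?_ h₁.continuousOn h₂.continuousOn ?_
  · filter_upwards [hae, ae_restrict_mem hS] with x hx hxS
    have h0 := hg0 x.1 hxS.1
    rw [ENNReal.mul_right_inj (by simpa using h0) ENNReal.ofReal_ne_top] at hx
    exact (ENNReal.ofReal_eq_ofReal_iff (h₁.nonneg _ hxS.1 _ hxS.2)
      (h₂.nonneg _ hxS.1 _ hxS.2)).1 hx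
  · rw [interior_prod_eq, interior_Ioi, interior_Icc, closure_prod_eq, closure_Ioi,
      closure_Ioo Real.pi_pos.ne]
    exact prod_mono Ioi_subset_Ici_self le_rfl

end Conditioning

/-! ### Norm, angle and Gaussian exponent in axial coordinates -/

section PolarGaussian

variable {E : Type*} [NormedAddCommGroup E] [InnerProductSpace ℝ E]

theorem norm_polar_axis {u : E} (hu : ‖u‖ = 1) (w : Metric.sphere (0 : (ℝ ∙ u)ᗮ) 1) {r : ℝ}
    (hr : 0 ≤ r) (φ : ℝ) :
    ‖(r * Real.cos φ) • u + (r * Real.sin φ) • ((w : (ℝ ∙ u)ᗮ) : E)‖ = r := by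
  have hw : ‖((w : (ℝ ∙ u)ᗮ) : E)‖ = 1 := norm_eq_of_mem_sphere w
  have huw : ⟪u, ((w : (ℝ ∙ u)ᗮ) : E)⟫ = 0 :=
    Submodule.mem_orthogonal_singleton_iff_inner_right.1 (w : (ℝ ∙ u)ᗮ).2
  rw [← sq_eq_sq₀ (norm_nonneg _) hr, norm_add_sq_real, norm_smul, norm_smul, hu, hw,
    real_inner_smul_left, real_inner_smul_right, huw, mul_one, mul_one, Real.norm_eq_abs,
    Real.norm_eq_abs, sq_abs, sq_abs]
  linear_combination r ^ 2 * Real.cos_sq_add_sin_sq φ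

theorem angle_polar_axis {u : E} (hu : ‖u‖ = 1) (w : Metric.sphere (0 : (ℝ ∙ u)ᗮ) 1) {r : ℝ}
    (hr : 0 < r) {φ : ℝ} (hφ : φ ∈ Icc 0 Real.pi) :
    InnerProductGeometry.angle u
      ((r * Real.cos φ) • u + (r * Real.sin φ) • ((w : (ℝ ∙ u)ᗮ) : E)) = φ := by
  have huw : ⟪u, ((w : (ℝ ∙ u)ᗮ) : E)⟫ = 0 :=
    Submodule.mem_orthogonal_singleton_iff_inner_right.1 (w : (ℝ ∙ u)ᗮ).2
  rw [InnerProductGeometry.angle, norm_polar_axis hu w hr.le, hu, inner_add_right,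
    real_inner_smul_right, real_inner_smul_right, huw, real_inner_self_eq_norm_sq, hu]
  simp only [one_pow, mul_one, mul_zero, add_zero, one_mul]
  rw [mul_div_cancel_left₀ _ hr.ne', Real.arccos_cos hφ.1 hφ.2]

variable [FiniteDimensional ℝ E]

theorem norm_polar_axis_sub_sq {u : E} (hu : ‖u‖ = 1) (w : Metric.sphere (0 : (ℝ ∙ u)ᗮ) 1) {r : ℝ}
    (hr : 0 ≤ r) (φ : ℝ) (m : E) :
    ‖(r * Real.cos φ) • u + (r * Real.sin φ) • ((w : (ℝ ∙ u)ᗮ) : E) - m‖ ^ 2 = r ^ 2 + ‖m‖ ^ 2 -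
      2 * (r * (⟪u, m⟫ * Real.cos φ +
        Real.sin φ * ⟪(ℝ ∙ u)ᗮ.orthogonalProjectionOnto m, (w : (ℝ ∙ u)ᗮ)⟫)) := by
  rw [norm_sub_sq_real, norm_polar_axis hu w hr, inner_add_left, real_inner_smul_left,
    real_inner_smul_left, Submodule.inner_orthogonalProjectionOnto_eq_of_mem_right,
    real_inner_comm m, real_inner_comm m]
  ring

theorem inner_sq_add_norm_sq_orthogonal {u : E} (hu : ‖u‖ = 1) (m : E) :
    ⟪u, m⟫ ^ 2 + ‖(ℝ ∙ u)ᗮ.orthogonalProjectionOnto m‖ ^ 2 = ‖m‖ ^ 2 := by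
  rw [Submodule.norm_sq_eq_add_norm_sq_projection m (ℝ ∙ u),
    Submodule.coe_norm ((ℝ ∙ u).orthogonalProjectionOnto m), ← Submodule.starProjection_apply, Submodule.starProjection_unit_singleton ℝ hu, norm_smul, hu]
  simp

end PolarGaussian

theorem measurable_angle {E : Type*} [NormedAddCommGroup E] [InnerProductSpace ℝ E]
    [MeasurableSpace E] [BorelSpace E] (v : E) :
    Measurable (InnerProductGeometry.angle v) :=
  Real.continuous_arccos.measurable.comp <|
    Measurable.div (Continuous.measurable (by fun_prop)) (Continuous.measurable (by fun_prop))

/-! ### Joint law of radius and angle -/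

section PolarJoint

variable {E : Type*} [NormedAddCommGroup E] [InnerProductSpace ℝ E] [FiniteDimensional ℝ E]
  [MeasurableSpace E] [BorelSpace E]

/-- The event depends only on (r, φ), so by Tonelli the integral over w can be done first, producing
the profile. The power r^(p+1) collects r from the planar Jacobian and r^p from the orthogonal
sphere. -/
theorem setLIntegral_gaussian_polar {u : E} (hu : ‖u‖ = 1) {p : ℕ}
    (hp : Module.finrank ℝ (ℝ ∙ u)ᗮ = p + 1) {c σ : ℝ} (hc : 0 ≤ c) (m : E)
    {A B : Set ℝ} (hA : MeasurableSet A) (hB : MeasurableSet B) :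
    ∫⁻ z in {z | ‖z‖ ∈ B ∧ InnerProductGeometry.angle u z ∈ A},
        ENNReal.ofReal (c * Real.exp (-(1 / (2 * σ ^ 2)) * ‖z - m‖ ^ 2)) =
      ∫⁻ r in B ∩ Ioi 0, ∫⁻ φ in A ∩ Icc 0 Real.pi, ENNReal.ofReal
        (c * r ^ (p + 1) * Real.exp (-(1 / (2 * σ ^ 2)) * (r ^ 2 + ‖m‖ ^ 2)) *
          angularProfile (volume : Measure (ℝ ∙ u)ᗮ).toSphere p (r * ((σ ^ 2)⁻¹ * ⟪u, m⟫))
            (r • (σ ^ 2)⁻¹ • (ℝ ∙ u)ᗮ.orthogonalProjectionOnto m) φ) := by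
  set S : Set E := {z | ‖z‖ ∈ B ∧ InnerProductGeometry.angle u z ∈ A} with hS
  have hSm : MeasurableSet S := (hB.preimage measurable_norm).inter (hA.preimage (measurable_angle u))
  set a := (σ ^ 2)⁻¹ * ⟪u, m⟫ with ha
  set q := (σ ^ 2)⁻¹ • (ℝ ∙ u)ᗮ.orthogonalProjectionOnto m with hq
  set ν := (volume : Measure (ℝ ∙ u)ᗮ).toSphere with hν
  set W : ℝ → ℝ := fun r =>
    c * r ^ (p + 1) * Real.exp (-(1 / (2 * σ ^ 2)) * (r ^ 2 + ‖m‖ ^ 2)) with hW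
  have hW0 : ∀ r, 0 < r → 0 ≤ W r := fun r hr => by positivity
  let G : ℝ × ℝ → Metric.sphere (0 : (ℝ ∙ u)ᗮ) 1 → ℝ := fun x w =>
    W x.1 * (|Real.sin x.2| ^ p *
      Real.exp (x.1 * a * Real.cos x.2 + Real.sin x.2 * ⟪x.1 • q, (w : (ℝ ∙ u)ᗮ)⟫))
  have hGm : Measurable (Function.uncurry G) := by
    refine Continuous.measurable ?_
    simp only [G, hW, Function.uncurry_def, real_inner_smul_left]
    fun_prop
  let χ : ℝ × ℝ → ℝ≥0∞ := (B ×ˢ A).indicator 1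
  have hχ : Measurable χ := measurable_one.indicator (hB.prod hA)
  have hpt : ∀ w : Metric.sphere (0 : (ℝ ∙ u)ᗮ) 1, ∀ r ∈ Ioi (0 : ℝ), ∀ φ ∈ Ioo 0 Real.pi,
      ENNReal.ofReal r * (ENNReal.ofReal ((r * Real.sin φ) ^ p) * S.indicator
        (fun z => ENNReal.ofReal (c * Real.exp (-(1 / (2 * σ ^ 2)) * ‖z - m‖ ^ 2)))
        ((r * Real.cos φ) • u + (r * Real.sin φ) • ((w : (ℝ ∙ u)ᗮ) : E))) =
      χ (r, φ) * ENNReal.ofReal (G (r, φ) w) := by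
    intro w r hr φ hφ
    have hr0 : 0 < r := hr
    have hs : 0 < Real.sin φ := Real.sin_pos_of_mem_Ioo hφ
    have hmem : (r * Real.cos φ) • u + (r * Real.sin φ) • ((w : (ℝ ∙ u)ᗮ) : E) ∈ S ↔
        (r, φ) ∈ B ×ˢ A := by
      rw [hS, mem_ofPred_eq, norm_polar_axis hu w hr0.le,
        angle_polar_axis hu w hr0 (Ioo_subset_Icc_self hφ), mem_prod]
    by_cases h : (r, φ) ∈ B ×ˢ A
    · rw [indicator_of_mem (hmem.2 h), show χ (r, φ) = 1 from indicator_of_mem h _, one_mul,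
        ← ENNReal.ofReal_mul (by positivity), ← ENNReal.ofReal_mul hr0.le,
        norm_polar_axis_sub_sq hu w hr0.le]
      congr 1
      simp only [G, hW, ha, hq, real_inner_smul_left, abs_of_pos hs]
      rw [show ∀ X Y : ℝ, -(1 / (2 * σ ^ 2)) * (X - 2 * Y) =
        -(1 / (2 * σ ^ 2)) * X + (σ ^ 2)⁻¹ * Y by intro X Y; rw [one_div, mul_inv]; ring,
        Real.exp_add, mul_pow]
      ring_nf
    · rw [indicator_of_notMem (mt hmem.1 h), show χ (r, φ) = 0 from indicator_of_notMem h _]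
      simp
  have hint : ∀ r ∈ Ioi (0 : ℝ), ∀ φ, ∫⁻ w, χ (r, φ) * ENNReal.ofReal (G (r, φ) w) ∂ν =
      χ (r, φ) * ENNReal.ofReal (W r * angularProfile ν p (r * a) (r • q) φ) := by
    intro r hr φ
    rw [lintegral_const_mul _ (hGm.of_uncurry_left).ennreal_ofReal,
      ← ofReal_integral_eq_lintegral_ofReal]
    · simp only [G, integral_const_mul, angularProfile]
    · exact ((integrable_exp_sphere ν _ _ _).const_mul _).const_mul _
    · exact .of_forall fun w => mul_nonneg (hW0 r hr) (by positivity)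
  rw [← lintegral_indicator hSm, lintegral_eq_lintegral_polar_axis hu hp
    (Measurable.indicator (by fun_prop) hSm)]
  calc _ = ∫⁻ w, (∫⁻ r in Ioi (0 : ℝ), ∫⁻ φ in Ioo 0 Real.pi,
        χ (r, φ) * ENNReal.ofReal (G (r, φ) w)) ∂ν :=
      lintegral_congr fun w => setLIntegral_congr_fun measurableSet_Ioi fun r hr =>
        setLIntegral_congr_fun measurableSet_Ioo fun φ hφ => hpt w r hr φ hφ
    _ = ∫⁻ w, (∫⁻ x, χ x * ENNReal.ofReal (G x w)
          ∂((volume.restrict (Ioi (0 : ℝ))).prod (volume.restrict (Ioo 0 Real.pi)))) ∂ν := by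
      refine lintegral_congr fun w => ?_
      rw [lintegral_prod]
      exact (hχ.mul hGm.of_uncurry_right.ennreal_ofReal).aemeasurable
    _ = ∫⁻ x, (∫⁻ w, χ x * ENNReal.ofReal (G x w) ∂ν)
          ∂((volume.restrict (Ioi (0 : ℝ))).prod (volume.restrict (Ioo 0 Real.pi))) := by
      rw [lintegral_lintegral_swap]
      refine Measurable.aemeasurable ?_
      exact (hχ.comp measurable_snd).mul
        (hGm.comp (measurable_snd.prodMk measurable_fst)).ennreal_ofReal
    _ = ∫⁻ r in Ioi (0 : ℝ), ∫⁻ φ in Ioo 0 Real.pi,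
          (∫⁻ w, χ (r, φ) * ENNReal.ofReal (G (r, φ) w) ∂ν) := by
      rw [lintegral_prod]
      refine (Measurable.lintegral_prod_right'
        (f := fun y : (ℝ × ℝ) × _ => χ y.1 * ENNReal.ofReal (G y.1 y.2)) ?_).aemeasurable
      exact (hχ.comp measurable_fst).mul hGm.ennreal_ofReal
    _ = ∫⁻ r in Ioi (0 : ℝ), B.indicator (fun r => ∫⁻ φ in A ∩ Icc 0 Real.pi,
          ENNReal.ofReal (W r * angularProfile ν p (r * a) (r • q) φ)) r := by
      refine setLIntegral_congr_fun measurableSet_Ioi fun r hr => ?_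
      simp_rw [hint r hr]
      rw [setLIntegral_congr Ioo_ae_eq_Icc]
      by_cases h : r ∈ B
      · rw [indicator_of_mem h, ← Measure.restrict_restrict hA, ← lintegral_indicator hA]
        refine lintegral_congr fun φ => ?_
        by_cases h' : φ ∈ A
        · rw [indicator_of_mem h', show χ (r, φ) = 1 from indicator_of_mem (mk_mem_prod h h') _,
            one_mul]
        · rw [indicator_of_notMem h', show χ (r, φ) = 0 from
            indicator_of_notMem (fun h'' => h' h''.2) _, zero_mul]
      · rw [indicator_of_notMem h]
        refine (lintegral_congr fun φ => ?_).trans lintegral_zero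
        rw [show χ (r, φ) = 0 from indicator_of_notMem (fun h'' => h h''.1) _, zero_mul]
    _ = _ := by rw [lintegral_indicator hB, Measure.restrict_restrict hB]

end PolarJoint

theorem hasPolarJointDensity_gaussian {p : ℕ} {v : EuclideanSpace ℝ (Fin (p + 2))} (hv : v ≠ 0)
    (x μ : EuclideanSpace ℝ (Fin (p + 2))) {σ : ℝ} (hσ : 0 < σ) {Ω : Type*} [MeasurableSpace Ω]
    {P : Measure Ω} {y : Ω → EuclideanSpace ℝ (Fin (p + 2))}
    (hy : HasLaw y
      (multivariateGaussian μ (σ ^ 2 • (1 : Matrix (Fin (p + 2)) (Fin (p + 2)) ℝ))) P) :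
    HasPolarJointDensity P (fun ω => InnerProductGeometry.angle v (x - y ω))
      (fun ω => ‖x - y ω‖)
      (fun r => (Real.pi * (2 * σ ^ 2)) ^ (-(Fintype.card (Fin (p + 2)) / 2 : ℝ)) * r ^ (p + 1) *
        Real.exp (-(1 / (2 * σ ^ 2)) * (r ^ 2 + ‖x - μ‖ ^ 2)))
      (fun r => angularProfile (volume : Measure (ℝ ∙ (‖v‖⁻¹ • v))ᗮ).toSphere p
        (r * ((σ ^ 2)⁻¹ * ⟪‖v‖⁻¹ • v, x - μ⟫))
        (r • (σ ^ 2)⁻¹ • (ℝ ∙ (‖v‖⁻¹ • v))ᗮ.orthogonalProjectionOnto (x - μ))) := by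
  intro A B hA hB
  have hu : ‖‖v‖⁻¹ • v‖ = 1 := norm_smul_inv_norm hv
  set u := ‖v‖⁻¹ • v with hu_def
  have hu0 : u ≠ 0 := fun h => by simp [h] at hu
  have : Fact (Module.finrank ℝ (EuclideanSpace ℝ (Fin (p + 2))) = p + 1 + 1) := ⟨by simp⟩
  have hang : ∀ z, InnerProductGeometry.angle v z = InnerProductGeometry.angle u z := fun z =>
    (InnerProductGeometry.angle_smul_left_of_pos v z (inv_pos.2 (norm_pos_iff.2 hv))).symm
  simp_rw [hang]
  set S : Set (EuclideanSpace ℝ (Fin (p + 2))) :=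
    {z | ‖z‖ ∈ B ∧ InnerProductGeometry.angle u z ∈ A} with hS
  have hSm : MeasurableSet S := (hB.preimage measurable_norm).inter (hA.preimage (measurable_angle u))
  have hTm : MeasurableSet ((fun y => x - y) ⁻¹' S) := hSm.preimage (by fun_prop)
  rw [← setLIntegral_gaussian_polar hu (Submodule.finrank_orthogonal_span_singleton hu0)
    (by positivity) _ hA hB, ← hS]
  refine (hy.measure_eq (p := fun y => x - y ∈ S) hTm).trans ?_
  rw [multivariateGaussian_smul_one_eq_withDensity μ hσ]
  refine (withDensity_apply _ hTm).trans ?_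
  rw [← lintegral_indicator hTm, ← lintegral_indicator hSm, ← lintegral_sub_left_eq_self _ x]
  refine lintegral_congr fun z => ?_
  have hz : ‖x - z - μ‖ = ‖z - (x - μ)‖ := by
    rw [sub_right_comm, norm_sub_rev]
  have hmem : x - z ∈ (fun y => x - y) ⁻¹' S ↔ z ∈ S := by simp
  by_cases h : z ∈ S
  · rw [indicator_of_mem (hmem.2 h), indicator_of_mem h, hz]
  · rw [indicator_of_notMem (mt hmem.1 h), indicator_of_notMem h]

end

theorem mainTheorem3 :
    ∃ C : ℝ, ∀ (d : ℕ), 2 ≤ d →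
      ∀ (L : AffineSubspace ℝ (EuclideanSpace ℝ (Fin d))) (x v : EuclideanSpace ℝ (Fin d)),
        Module.finrank ℝ L.direction = 1 → x ∈ L → v ∈ L.direction → v ≠ 0 →
      ∀ (μ : EuclideanSpace ℝ (Fin d)) (σ : ℝ), 0 < σ →
      ∀ (Ω : Type*) [MeasurableSpace Ω] (P : Measure Ω) [IsProbabilityMeasure P]
        (y : Ω → EuclideanSpace ℝ (Fin d)),
        HasLaw y (multivariateGaussian μ (σ ^ 2 • (1 : Matrix (Fin d) (Fin d) ℝ))) P →
      (∃ f : ℝ → ℝ → ℝ, IsCondAngleDensity P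
        (fun ω => InnerProductGeometry.angle v (x - y ω)) (fun ω => ‖x - y ω‖) f) ∧
      ∀ f : ℝ → ℝ → ℝ, IsCondAngleDensity P
          (fun ω => InnerProductGeometry.angle v (x - y ω)) (fun ω => ‖x - y ω‖) f →
        ∀ r : ℝ, 0 < r →
          (∀ φ ∈ Icc 0 Real.pi,
            f r φ ≤ C * (√(d : ℝ) + √(r * ‖x - μ‖) / σ)) ∧
          (3 ≤ d → ∀ φ ∈ Ioo 0 Real.pi,
            f r φ / Real.sin φ ≤ C * (√(d : ℝ) + r * ‖x - μ‖ / (σ ^ 2 * √(d : ℝ)))) := by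

  refine ⟨20, ?_⟩
  intro d hd L x v _ _ _ hv μ σ hσ Ω _ P _ y hy
  -- p = d - 2 is the exponent of sin φ, so d ≥ 3 will mean p ≥ 1.
  obtain ⟨p, rfl⟩ := Nat.exists_eq_add_of_le' hd
  have hJ := hasPolarJointDensity_gaussian hv x μ hσ hy
  have hu : ‖‖v‖⁻¹ • v‖ = 1 := norm_smul_inv_norm hv
  set u := ‖v‖⁻¹ • v with hu_def
  have hu0 : u ≠ 0 := fun h => by simp [h] at hu
  have : Fact (Module.finrank ℝ (EuclideanSpace ℝ (Fin (p + 2))) = p + 1 + 1) := ⟨by simp⟩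
  have : Nontrivial (ℝ ∙ u)ᗮ := Module.nontrivial_of_finrank_pos (R := ℝ) (by
    rw [Submodule.finrank_orthogonal_span_singleton (n := p + 1) hu0]; omega)
  set ν := (volume : Measure (ℝ ∙ u)ᗮ).toSphere with hν
  have : NeZero ν := ⟨Measure.toSphere_ne_zero _⟩
  have hneg : MeasurePreserving (fun w : Metric.sphere (0 : (ℝ ∙ u)ᗮ) 1 => -w) ν ν :=
    measurePreserving_neg_toSphere _
  set a := (σ ^ 2)⁻¹ * inner ℝ u (x - μ) with ha
  set q := (σ ^ 2)⁻¹ • (ℝ ∙ u)ᗮ.orthogonalProjectionOnto (x - μ) with hq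
  have hF := continuous_angularProfile_smul ν p a q
  have hF0 : ∀ r φ, 0 ≤ angularProfile ν p (r * a) (r • q) φ := fun r φ =>
    angularProfile_nonneg ν p _ _ φ
  have hZ : ∀ r, 0 < ∫ φ in 0..Real.pi, angularProfile ν p (r * a) (r • q) φ := fun r =>
    intervalIntegral.intervalIntegral_pos_of_pos_on
      ((continuous_angularProfile ν p _ _).intervalIntegrable _ _)
      (fun φ hφ => angularProfile_pos ν p _ _ (Real.sin_pos_of_mem_Ioo hφ).ne') Real.pi_pos
  have hR : AEMeasurable (fun ω => ‖x - y ω‖) P := (hy.aemeasurable.const_sub x).norm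
  have hex := isCondAngleDensity_of_hasPolarJointDensity hR hJ hF hF0 hZ (by fun_prop)
    fun r hr => by positivity
  refine ⟨⟨_, hex⟩, fun f hf r hr => ?_⟩
  have hP := map_eq_withDensity_of_hasPolarJointDensity hR hJ hF hF0 fun r hr => by positivity
  have heq : ∀ φ ∈ Icc 0 Real.pi, f r φ = angularProfile ν p (r * a) (r • q) φ /
      ∫ ψ in 0..Real.pi, angularProfile ν p (r * a) (r • q) ψ := fun φ hφ =>
    IsCondAngleDensity.eqOn (by
        refine Continuous.mul (by fun_prop) ?_
        exact intervalIntegral.continuous_parametric_intervalIntegral_of_continuous' hF _ _)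
      (fun r hr => mul_pos (by positivity) (hZ r)) hP hf hex (mk_mem_prod hr hφ)
  have hκ : 0 ≤ r * ‖x - μ‖ / σ ^ 2 := by positivity
  -- An equality, by Pythagoras: the concentration is κ = rs/σ², whose square root is the √(rs)/σ of
  -- the first bound.
  have hnorm : (r * a) ^ 2 + ‖r • q‖ ^ 2 ≤ (r * ‖x - μ‖ / σ ^ 2) ^ 2 := by
    rw [norm_smul, hq, norm_smul, Real.norm_eq_abs, Real.norm_eq_abs, mul_pow |r|, mul_pow |_|,
      sq_abs, sq_abs, div_pow, mul_pow r ‖x - μ‖, ← inner_sq_add_norm_sq_orthogonal hu (x - μ), ha]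
    refine le_of_eq ?_
    field_simp
  have hcast : ((p + 2 : ℕ) : ℝ) = p + 2 := by push_cast; ring
  refine ⟨fun φ hφ => ?_, fun hd3 φ hφ => ?_⟩
  · rw [heq φ hφ, div_le_iff₀ (hZ r), hcast]
    have hs : √(r * ‖x - μ‖) / σ = √(r * ‖x - μ‖ / σ ^ 2) := by
      rw [Real.sqrt_div (by positivity), Real.sqrt_sq hσ.le]
    rw [hs]
    exact angularProfile_le_sqrt ν hneg hκ hnorm hφ
  · have hs : 0 < Real.sin φ := Real.sin_pos_of_mem_Ioo hφ
    have hφ' := Ioo_subset_Icc_self hφ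
    rw [heq φ hφ', div_right_comm, div_le_iff₀ (hZ r), div_le_iff₀ hs, hcast, ← div_div]
    exact angularProfile_le_mul_sin ν hneg hκ hnorm (by omega) hφ'
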